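/- **Notation.** For a metric space $(X,\mathrm d)$ let $\mathcal P_2(X)$ be the set of Borel probability measures $\mu$ on $X$ with $\int_X \mathrm d(x,x_0)^2\,d\mu(x)<\infty$ for some $x_0\in X$. For $\mu,\nu\in\mathcal P_2(X)$, let the set of couplings of $\mu$ and $\nu$ be the set of all $\pi\in\mathcal P_2(X\times X)$ with $\mathrm{proj}^0_\sharp\pi=\mu$ and $\mathrm{proj}^1_\sharp\pi=\nu$, where $\mathrm{proj}^i(x_0,x_1)=x_i$, and let $W_2(\mu,\nu)^2$ be the infimum of $\int_{X\times X}\mathrm d(x,x')^2\,d\pi(x,x')$ over all such couplings. The set of couplings is denoted by $\mathrm c(\mu,\nu)$ when $X=\mathbb R^d$ with the Euclidean distance. When $X=\mathcal P_2(\mathbb R^d)$ with the distance $W_2$ and its Borel $\sigma$-algebra, and $\boldsymbol\mu,\boldsymbol\nu\in\mathcal P_2(\mathcal P_2(\mathbb R^d))$, it is denoted by $\mathrm C(\boldsymbol\mu,\boldsymbol\nu)$ (the outer plans), and the resulting distance (the Wasserstein-on-Wasserstein, or WoW, distance) by $\mathbf W_2(\boldsymbol\mu,\boldsymbol\nu)$.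 The set of random couplings of $\boldsymbol\mu$ and $\boldsymbol\nu$ is $$\mathrm{RC}(\boldsymbol\mu,\boldsymbol\nu)=\{\mathbf\Pi\in\mathcal P(\mathcal P(\mathbb R^d\times\mathbb R^d)) : \mathbf{Proj}^0_\sharp\mathbf\Pi=\boldsymbol\mu,\ \mathbf{Proj}^1_\sharp\mathbf\Pi=\boldsymbol\nu\},\qquad \mathbf{Proj}^i(\pi)=\mathrm{proj}^i_\sharp\pi,$$ where $\boldsymbol\mu,\boldsymbol\nu$ are regarded as measures on $\mathcal P(\mathbb R^d)$ through the inclusion $\mathcal P_2(\mathbb R^d)\subset\mathcal P(\mathbb R^d)$. **Lemma.** Let $\boldsymbol\mu,\boldsymbol\nu\in\mathcal P_2(\mathcal P_2(\mathbb R^d))$. Then, for every $\mathrm{OP}\in\mathrm C(\boldsymbol\mu,\boldsymbol\nu)$ and every $\mathrm{OP}$-measurable map $\mathrm{IP}:(\mu,\nu)\mapsto\mathrm{IP}_{\mu,\nu}$ from $\mathcal P_2(\mathbb R^d)\times\mathcal P_2(\mathbb R^d)$ to $\mathcal P(\mathbb R^d\times\mathbb R^d)$ with $\mathrm{IP}_{\mu,\nu}\in\mathrm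 c(\mu,\nu)$ for all $\mu,\nu$, one has $$\mathrm{IP}_\sharp\,\mathrm{OP}\in\mathrm{RC}(\boldsymbol\mu,\boldsymbol\nu).$$ Moreover, $$\mathbf W_2^2(\boldsymbol\mu,\boldsymbol\nu)=\inf_{\mathbf\Pi\in\mathrm{RC}(\boldsymbol\mu,\boldsymbol\nu)}\int_{\mathcal P(\mathbb R^d\times\mathbb R^d)}\int_{\mathbb R^d\times\mathbb R^d}\|x-x'\|^2\,d\pi(x,x')\,d\mathbf\Pi(\pi).$$ -/

import Mathlib

open MeasureTheory
open scoped ENNReal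

/-- `𝒫₂(X)`: probability measures on `X` with finite second moment `∫ d(x, x₀)² dμ(x)` for some
`x₀`. Only the `MeasurableSpace` and the distance `edist` of `X` enter, so that the same definition
applies to `X = ℝᵈ` and to `X = 𝒫₂(ℝᵈ)` with its Wasserstein distance. -/
@[ext]
structure P2 (X : Type*) [MeasurableSpace X] [EDist X] where
  /-- The underlying probability measure, i.e. the inclusion `𝒫₂(X) → 𝒫(X)`. -/
  toPM : ProbabilityMeasure X
  finite_moment : ∃ x₀ : X, ∫⁻ x, edist x x₀ ^ 2 ∂(toPM : Measure X) < ∞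

/-- The couplings (transport plans) of `μ` and `ν`: probability measures on `X × X` with finite
second moment (for the product distance `(d(x, x₀)² + d(x', x₀')²)^(1/2)`) and with
marginals `μ` and `ν`. -/
def couplings {X : Type*} [MeasurableSpace X] [EDist X] (μ ν : P2 X) :
    Set (ProbabilityMeasure (X × X)) :=
  {π | (∃ x₀ x₀' : X,
          ∫⁻ z, (edist z.1 x₀ ^ 2 + edist z.2 x₀' ^ 2) ∂(π : Measure (X × X)) < ∞) ∧
        π.map measurable_fst.aemeasurable = μ.toPM ∧
        π.map measurable_snd.aemeasurable = ν.toPM}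

/-- The Wasserstein distance `W₂(μ, ν) = (inf_π ∫ d(x, x')² dπ(x, x'))^(1/2)`, the infimum being
over all couplings `π` of `μ` and `ν`. -/
noncomputable def W2 {X : Type*} [MeasurableSpace X] [EDist X] (μ ν : P2 X) : ℝ≥0∞ :=
  (⨅ π ∈ couplings μ ν, ∫⁻ z, edist z.1 z.2 ^ 2 ∂(π : Measure (X × X))) ^ (1 / 2 : ℝ)

/-- `𝒫₂(X)` carries the distance `W₂`. -/
noncomputable instance P2.instEDist {X : Type*} [MeasurableSpace X] [EDist X] : EDist (P2 X) :=
  ⟨W2⟩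

/-- The topology of `𝒫₂(X)` is the one generated by the open balls of `W₂`. -/
instance P2.instTopologicalSpace {X : Type*} [MeasurableSpace X] [EDist X] :
    TopologicalSpace (P2 X) :=
  TopologicalSpace.generateFrom {B | ∃ (μ : P2 X) (r : ℝ≥0∞), B = {ν | W2 μ ν < r}}

/-- `𝒫₂(X)` carries the Borel σ-algebra of its Wasserstein topology. -/
instance P2.instMeasurableSpace {X : Type*} [MeasurableSpace X] [EDist X] :
    MeasurableSpace (P2 X) :=
  borel (P2 X)

instance P2.instBorelSpace {X : Type*} [MeasurableSpace X] [EDist X] : BorelSpace (P2 X) :=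
  ⟨rfl⟩

/-- `W₂(μ, μ) = 0`: the diagonal coupling is admissible. -/
theorem P2.W2_self {X : Type*} [PseudoEMetricSpace X] [MeasurableSpace X] [BorelSpace X]
    [SecondCountableTopology X] (μ : P2 X) : W2 μ μ = 0 := by
  have hd : Measurable (fun x : X => (x, x)) := by fun_prop
  obtain ⟨x₀, hx₀⟩ := μ.finite_moment
  have hmem : μ.toPM.map (f := fun x => (x, x)) hd.aemeasurable ∈ couplings μ μ := by
    refine ⟨⟨x₀, x₀, ?_⟩, ?_, ?_⟩
    · rw [ProbabilityMeasure.toMeasure_map, lintegral_map (by fun_prop) hd,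
        lintegral_add_left (by fun_prop)]
      exact ENNReal.add_lt_top.2 ⟨hx₀, hx₀⟩
    · refine Subtype.ext ?_
      simp only [ProbabilityMeasure.val_eq_to_measure, ProbabilityMeasure.toMeasure_map]
      rw [Measure.map_map measurable_fst hd]
      exact Measure.map_id
    · refine Subtype.ext ?_
      simp only [ProbabilityMeasure.val_eq_to_measure, ProbabilityMeasure.toMeasure_map]
      rw [Measure.map_map measurable_snd hd]
      exact Measure.map_id
  have h0 : (⨅ π ∈ couplings μ μ, ∫⁻ z, edist z.1 z.2 ^ 2 ∂(π : Measure (X × X))) = 0 := by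
    refine le_antisymm ((iInf₂_le _ hmem).trans ?_) zero_le
    rw [ProbabilityMeasure.toMeasure_map, lintegral_map (by fun_prop) hd]
    simp
  rw [W2, h0]
  simp

/-- The inclusion `𝒫₂(X) → 𝒫(X)` is measurable. -/
theorem P2.measurable_toPM {X : Type*} [PseudoEMetricSpace X] [MeasurableSpace X] [BorelSpace X]
    [SecondCountableTopology X] : Measurable (P2.toPM : P2 X → ProbabilityMeasure X) := by
  refine Measurable.subtype_mk ?_
  have : ∀ μ : P2 X, IsProbabilityMeasure (μ.toPM : Measure X) := fun μ => inferInstance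
  refine Measurable.measure_of_isPiSystem_of_isProbabilityMeasure
    (μ := fun μ : P2 X => (μ.toPM : Measure X))
    (BorelSpace.measurable_eq.trans borel_eq_generateFrom_isClosed) isPiSystem_isClosed ?_
  intro F hF
  have hF : IsClosed F := hF
  refine UpperSemicontinuous.measurable ?_
  intro μ a ha
  change (μ.toPM : Measure X) F < a at ha
  obtain ⟨δ, hδ, hδa⟩ : ∃ δ : ℝ, 0 < δ ∧ (μ.toPM : Measure X) (Metric.cthickening δ F) < a := by
    have h := (tendsto_measure_cthickening_of_isClosed
      ⟨1, one_pos, measure_ne_top (μ.toPM : Measure X) _⟩ hF).eventually_lt_const ha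
    have h2 := h.filter_mono (nhdsWithin_le_nhds (s := Set.Ioi 0))
    obtain ⟨δ, h3, h4⟩ := (h2.and self_mem_nhdsWithin).exists
    exact ⟨δ, h4, h3⟩
  obtain ⟨b, hb0, hb⟩ : ∃ b : ℝ≥0∞, 0 < b ∧
      (μ.toPM : Measure X) (Metric.cthickening δ F) + b < a := by
    obtain ⟨c, h1, h2⟩ := exists_between hδa
    exact ⟨c - (μ.toPM : Measure X) (Metric.cthickening δ F), tsub_pos_of_lt h1,
      by rwa [add_tsub_cancel_of_le h1.le]⟩
  have hδ' : ENNReal.ofReal δ ^ 2 ≠ 0 := by simp [hδ]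
  have hδ'' : ENNReal.ofReal δ ^ 2 ≠ ∞ := by finiteness
  have hr0 : 0 < (b * ENNReal.ofReal δ ^ 2) ^ (1 / 2 : ℝ) :=
    ENNReal.rpow_pos_of_nonneg (pos_iff_ne_zero.2 (mul_ne_zero hb0.ne' hδ')) (by norm_num)
  have hopen : IsOpen {ν : P2 X | W2 μ ν < (b * ENNReal.ofReal δ ^ 2) ^ (1 / 2 : ℝ)} :=
    TopologicalSpace.isOpen_generateFrom_of_mem ⟨μ, _, rfl⟩
  filter_upwards [hopen.mem_nhds (by simpa [P2.W2_self] using hr0)] with ν hν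
  have hν : W2 μ ν < (b * ENNReal.ofReal δ ^ 2) ^ (1 / 2 : ℝ) := hν
  rw [W2, ENNReal.rpow_lt_rpow_iff (by norm_num)] at hν
  obtain ⟨π, hπ⟩ := iInf_lt_iff.1 hν
  obtain ⟨⟨-, h1, h2⟩, hc⟩ := iInf_lt_iff.1 hπ
  have h1' : (π : Measure (X × X)).map Prod.fst = (μ.toPM : Measure X) :=
    congrArg (fun m : ProbabilityMeasure X => (m : Measure X)) h1
  have h2' : (π : Measure (X × X)).map Prod.snd = (ν.toPM : Measure X) :=
    congrArg (fun m : ProbabilityMeasure X => (m : Measure X)) h2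
  have hM : (π : Measure (X × X)) {z | ENNReal.ofReal δ ^ 2 ≤ edist z.1 z.2 ^ 2} ≤ b :=
    (meas_ge_le_lintegral_div (by fun_prop) hδ' hδ'').trans (ENNReal.div_le_of_le_mul hc.le)
  have hsub : Prod.snd ⁻¹' F ⊆ Prod.fst ⁻¹' (Metric.cthickening δ F) ∪
      {z : X × X | ENNReal.ofReal δ ^ 2 ≤ edist z.1 z.2 ^ 2} := by
    intro z hz
    by_cases hz1 : z.1 ∈ Metric.cthickening δ F
    · exact Or.inl hz1
    · refine Or.inr ?_
      have : ENNReal.ofReal δ < Metric.infEDist z.1 F := not_le.1 hz1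
      exact pow_le_pow_left' (this.le.trans (Metric.infEDist_le_edist_of_mem hz)) 2
  calc (ν.toPM : Measure X) F = (π : Measure (X × X)) (Prod.snd ⁻¹' F) := by
        rw [← h2', Measure.map_apply measurable_snd hF.measurableSet]
    _ ≤ (π : Measure (X × X)) (Prod.fst ⁻¹' (Metric.cthickening δ F)) +
        (π : Measure (X × X)) {z | ENNReal.ofReal δ ^ 2 ≤ edist z.1 z.2 ^ 2} :=
        (measure_mono hsub).trans (measure_union_le _ _)
    _ ≤ (μ.toPM : Measure X) (Metric.cthickening δ F) + b := by
        rw [← h1', Measure.map_apply measurable_fst Metric.isClosed_cthickening.measurableSet]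
        gcongr
    _ < a := hb

/-- Taking marginals is a measurable map `𝒫(X × Y) → 𝒫(Z)` for `Z = X` or `Z = Y`; more generally
the push-forward of measures along a measurable map is measurable. -/
theorem measurable_probabilityMeasure_map {X Y : Type*} [MeasurableSpace X] [MeasurableSpace Y]
    {f : X → Y} (hf : Measurable f) :
    Measurable (fun π : ProbabilityMeasure X => π.map (hf.aemeasurable (μ := (π : Measure X)))) := by
  refine Measurable.subtype_mk ?_
  exact (Measure.measurable_map f hf).comp measurable_subtype_coe

/-- `ℝᵈ` with the Euclidean norm. -/
abbrev Euc (d : ℕ) : Type := EuclideanSpace ℝ (Fin d)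

/-- The random couplings of `μ, ν ∈ 𝒫₂(𝒫₂(ℝᵈ))`: probability measures `Γ` on `𝒫(ℝᵈ × ℝᵈ)` whose
push-forwards along the two marginal maps `𝒫(ℝᵈ × ℝᵈ) → 𝒫(ℝᵈ)` are `μ` and `ν`, the latter being
regarded as measures on `𝒫(ℝᵈ)` through the inclusion `𝒫₂(ℝᵈ) → 𝒫(ℝᵈ)`. -/
noncomputable def randomCouplings {d : ℕ} (μ ν : P2 (P2 (Euc d))) :
    Set (ProbabilityMeasure (ProbabilityMeasure (Euc d × Euc d))) :=
  {Γ | Γ.map (measurable_probabilityMeasure_map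
          (measurable_fst (α := Euc d) (β := Euc d))).aemeasurable =
        μ.toPM.map P2.measurable_toPM.aemeasurable ∧
      Γ.map (measurable_probabilityMeasure_map
          (measurable_snd (α := Euc d) (β := Euc d))).aemeasurable =
        ν.toPM.map P2.measurable_toPM.aemeasurable}

/-! The marginals of a pushforward along `IP` are read off pointwise, which gives the first claim.
For the formula, a random coupling sends `Γ` to the joint law of the two marginals of `π`, an outer
plan; as `π` itself couples its marginals, the cost does not increase. Conversely, an outer plan is
pushed forward by a measurable choice of couplings that are optimal up to `ε`.

The difficulty is measurability. Every `m` in `𝒫(E)` is the law of `f m U` with `f` jointly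
measurable and `U` uniform on `I`, so a coupling of two measures is the image of a coupling of the
uniform law with itself. By separability of `L²(I; E)`, countably many of the latter approximate all
costs (`exists_seq_uniform_couplings`). Hence `W2` is a countable infimum of costs of couplings
depending measurably on the marginals (`exists_seq_measurable_couplings`). This yields measurability
of `W2`, the selection, and the comparison of the Borel structures of `𝒫₂(E)` and `𝒫(E)`. -/

open ProbabilityTheory unitInterval

/-! ### Gluing, and couplings of the uniform law on the unit interval -/

/-- Gluing of measures: `α` on `A × B` and `β` on `B × C` with the same marginal on `B` are the
marginals of a measure on `A × B × C`. -/
theorem exists_gluing {A B C : Type*} [MeasurableSpace A] [MeasurableSpace B] [MeasurableSpace C]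
    [StandardBorelSpace C] [Nonempty C] (α : Measure (A × B)) (β : Measure (B × C))
    [IsProbabilityMeasure α] [IsProbabilityMeasure β] (h : α.map Prod.snd = β.map Prod.fst) :
    ∃ ρ : Measure (A × B × C), IsProbabilityMeasure ρ ∧
      ρ.map (fun z => (z.1, z.2.1)) = α ∧ ρ.map Prod.snd = β := by
  -- The third coordinate is drawn given the second alone, so the outer coordinates are
  -- conditionally independent.
  set κ : Kernel (A × B) C := β.condKernel.comap Prod.snd measurable_snd with hκ
  have hm : Measurable (fun z : (A × B) × C => (z.1.1, z.1.2, z.2)) := by fun_prop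
  refine ⟨(α ⊗ₘ κ).map (fun z => (z.1.1, z.1.2, z.2)),
    Measure.isProbabilityMeasure_map hm.aemeasurable, ?_, ?_⟩
  · rw [Measure.map_map (by fun_prop) hm]
    exact Measure.fst_compProd α κ
  · rw [Measure.map_map (by fun_prop) hm]
    ext s hs
    rw [Measure.map_apply (by fun_prop) hs, Measure.compProd_apply
      (measurable_snd.comp hm hs)]
    have hg : Measurable fun b => β.condKernel b (Prod.mk b ⁻¹' s) :=
      Kernel.measurable_kernel_prodMk_left hs
    calc ∫⁻ a, κ a (Prod.mk a ⁻¹' (Prod.snd ∘ (fun z : (A × B) × C => (z.1.1, z.1.2, z.2)) ⁻¹' s)) ∂α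
        = ∫⁻ a, β.condKernel a.2 (Prod.mk a.2 ⁻¹' s) ∂α := rfl
      _ = ∫⁻ b, β.condKernel b (Prod.mk b ⁻¹' s) ∂(β.fst) := by
        rw [Measure.fst, ← h, lintegral_map hg measurable_snd]
      _ = β s := by
        rw [← Measure.compProd_apply hs, Measure.disintegrate]

/-- A coupling of the laws of `f` and `g`, defined on the unit interval, is the law of
`(f U, g V)` for uniformly distributed `U` and `V`. -/
theorem exists_uniform_coupling_map_eq {E F : Type*} [MeasurableSpace E] [StandardBorelSpace E]
    [MeasurableSpace F] [StandardBorelSpace F] {f : I → E} {g : I → F} (hf : Measurable f)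
    (hg : Measurable g)
    (π : Measure (E × F)) [IsProbabilityMeasure π] (h1 : π.map Prod.fst = volume.map f)
    (h2 : π.map Prod.snd = volume.map g) :
    ∃ γ : Measure (I × I), γ.map Prod.fst = volume ∧ γ.map Prod.snd = volume ∧
      γ.map (Prod.map f g) = π := by
  have hne : Nonempty F := ⟨g 0⟩
  have hfm : Measurable fun u => (u, f u) := by fun_prop
  have hgm : Measurable fun v => (g v, v) := by fun_prop
  have : IsProbabilityMeasure ((volume : Measure I).map fun u => (u, f u)) :=
    Measure.isProbabilityMeasure_map hfm.aemeasurable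
  have : IsProbabilityMeasure ((volume : Measure I).map fun v => (g v, v)) :=
    Measure.isProbabilityMeasure_map hgm.aemeasurable
  -- Two gluings: the law of `(U, f U)` to `π` along `E`, then the result to the law of `(g V, V)`
  -- along `F`.
  obtain ⟨ρ, _, hρ1, hρ2⟩ := exists_gluing ((volume : Measure I).map fun u => (u, f u)) π (by
    rw [Measure.map_map measurable_snd hfm, h1]; rfl)
  have hm : Measurable fun z : I × E × F => ((z.1, z.2.1), z.2.2) := by fun_prop
  have : IsProbabilityMeasure (ρ.map fun z => ((z.1, z.2.1), z.2.2)) :=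
    Measure.isProbabilityMeasure_map hm.aemeasurable
  obtain ⟨τ, _, hτ1, hτ2⟩ := exists_gluing (ρ.map fun z => ((z.1, z.2.1), z.2.2))
    ((volume : Measure I).map fun v => (g v, v)) (by
      rw [Measure.map_map measurable_snd hm, Measure.map_map measurable_fst hgm]
      change ρ.map (Prod.snd ∘ Prod.snd) = volume.map g
      rw [← Measure.map_map measurable_snd measurable_snd, hρ2, h2])
  have hτ3 : τ.map Prod.fst = (volume : Measure I).map fun u => (u, f u) := by
    rw [← hρ1]
    have := congrArg (Measure.map Prod.fst) hτ1
    rwa [Measure.map_map measurable_fst (by fun_prop), Measure.map_map measurable_fst hm] at this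
  have hτ4 : τ.map (fun z => (z.1.2, z.2.1)) = π := by
    rw [← hρ2]
    have := congrArg (Measure.map fun z : (I × E) × F => (z.1.2, z.2)) hτ1
    rwa [Measure.map_map (by fun_prop) (by fun_prop), Measure.map_map (by fun_prop) hm] at this
  have hfe : ∀ᵐ z ∂τ, f z.1.1 = z.1.2 := by
    have : ∀ᵐ w ∂(τ.map Prod.fst), f w.1 = w.2 := by
      rw [hτ3, ae_map_iff hfm.aemeasurable
        (measurableSet_eq_fun (by fun_prop) (by fun_prop))]
      simp
    exact ae_of_ae_map measurable_fst.aemeasurable this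
  have hge : ∀ᵐ z ∂τ, g z.2.2 = z.2.1 := by
    have : ∀ᵐ w ∂(τ.map Prod.snd), g w.2 = w.1 := by
      rw [hτ2, ae_map_iff hgm.aemeasurable
        (measurableSet_eq_fun (by fun_prop) (by fun_prop))]
      simp
    exact ae_of_ae_map measurable_snd.aemeasurable this
  refine ⟨τ.map fun z => (z.1.1, z.2.2), ?_, ?_, ?_⟩
  · rw [Measure.map_map measurable_fst (by fun_prop)]
    have := congrArg (Measure.map Prod.fst) hτ3
    rw [Measure.map_map measurable_fst measurable_fst, Measure.map_map measurable_fst hfm] at this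
    exact this.trans Measure.map_id
  · rw [Measure.map_map measurable_snd (by fun_prop)]
    have := congrArg (Measure.map Prod.snd) hτ2
    rw [Measure.map_map measurable_snd measurable_snd, Measure.map_map measurable_snd hgm] at this
    exact this.trans Measure.map_id
  · rw [Measure.map_map (by fun_prop) (by fun_prop), ← hτ4]
    refine Measure.map_congr ?_
    filter_upwards [hfe, hge] with z h1 h2
    simp [h1, h2]

/-- Countably many couplings of the uniform measure with itself suffice to approximate the
quadratic cost of every such coupling, simultaneously for all square integrable maps. -/
theorem exists_seq_uniform_couplings (E : Type*) [NormedAddCommGroup E]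
    [SecondCountableTopology E] :
    ∃ γ : ℕ → Measure (I × I),
      (∀ n, (γ n).map Prod.fst = volume ∧ (γ n).map Prod.snd = volume) ∧
      ∀ γ' : Measure (I × I), γ'.map Prod.fst = volume → γ'.map Prod.snd = volume →
        ∀ f g : I → E, MemLp f 2 volume → MemLp g 2 volume → ∀ ε : ℝ≥0∞, 0 < ε →
          ∃ n, eLpNorm (fun z => f z.1 - g z.2) 2 (γ n) ≤
            eLpNorm (fun z => f z.1 - g z.2) 2 γ' + ε := by
  let K := {γ : Measure (I × I) // γ.map Prod.fst = volume ∧ γ.map Prod.snd = volume}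
  have hmp1 : ∀ γ : K, MeasurePreserving Prod.fst γ.1 volume := fun γ => ⟨measurable_fst, γ.2.1⟩
  have hmp2 : ∀ γ : K, MeasurePreserving Prod.snd γ.1 volume := fun γ => ⟨measurable_snd, γ.2.2⟩
  have hmf : ∀ (γ : K) (f : I → E), AEStronglyMeasurable f volume →
      AEStronglyMeasurable (fun z : I × I => f z.1) γ.1 := fun γ f hf =>
    hf.comp_measurePreserving (hmp1 γ)
  have hms : ∀ (γ : K) (f : I → E), AEStronglyMeasurable f volume →
      AEStronglyMeasurable (fun z : I × I => f z.2) γ.1 := fun γ f hf =>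
    hf.comp_measurePreserving (hmp2 γ)
  have hnf : ∀ (γ : K) (f : I → E), AEStronglyMeasurable f volume →
      eLpNorm (fun z : I × I => f z.1) 2 γ.1 = eLpNorm f 2 volume := fun γ f hf =>
    eLpNorm_comp_measurePreserving hf (hmp1 γ)
  have hns : ∀ (γ : K) (f : I → E), AEStronglyMeasurable f volume →
      eLpNorm (fun z : I × I => f z.2) 2 γ.1 = eLpNorm f 2 volume := fun γ f hf =>
    eLpNorm_comp_measurePreserving hf (hmp2 γ)
  have hKne : Nonempty K := by
    have hd : Measurable fun u : I => (u, u) := by fun_prop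
    refine ⟨⟨(volume : Measure I).map fun u => (u, u), ?_, ?_⟩⟩
    · rw [Measure.map_map measurable_fst hd]; exact Measure.map_id
    · rw [Measure.map_map measurable_snd hd]; exact Measure.map_id
  have : Fact ((1 : ℝ≥0∞) ≤ 2) := ⟨by norm_num⟩
  have : Fact ((2 : ℝ≥0∞) ≠ ∞) := ⟨by norm_num⟩
  let φ : ℕ → Lp E 2 (volume : Measure I) := TopologicalSpace.denseSeq _
  -- A self-coupling is recorded only through its costs on a dense sequence of `L²`. The induced
  -- topology is second countable, hence separable, and no compactness is needed.
  let Ψ : K → ℕ × ℕ → ℝ≥0∞ := fun γ ij => eLpNorm (fun z => φ ij.1 z.1 - φ ij.2 z.2) 2 γ.1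
  let _ : TopologicalSpace K := TopologicalSpace.induced Ψ inferInstance
  have hΨ : Topology.IsInducing Ψ := ⟨rfl⟩
  have : SecondCountableTopology K := hΨ.secondCountableTopology
  refine ⟨fun n => (TopologicalSpace.denseSeq K n).1,
    fun n => (TopologicalSpace.denseSeq K n).2, fun γ' h1 h2 f g hf hg ε hε => ?_⟩
  -- There are five errors of size `ε / 5`: replacing `f` and `g` under the chosen coupling,
  -- replacing them back under `γ'`, and passing between the two couplings.
  have hclose : ∀ f : I → E, MemLp f 2 volume → ∃ i, eLpNorm (f - ⇑(φ i)) 2 volume ≤ ε / 5 ∧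
      eLpNorm (⇑(φ i) - f) 2 volume ≤ ε / 5 := fun f hf => by
    obtain ⟨_, ⟨i, rfl⟩, hi⟩ := EMetric.mem_closure_iff.1
      ((TopologicalSpace.denseRange_denseSeq (Lp E 2 (volume : Measure I))).closure_eq ▸
        Set.mem_univ (hf.toLp f)) (ε / 5) (ENNReal.div_pos hε.ne' (by norm_num))
    have h3 : eLpNorm (f - ⇑(φ i)) 2 volume ≤ ε / 5 := by
      rw [Lp.edist_def] at hi
      refine le_trans (le_of_eq (eLpNorm_congr_ae ?_)) hi.le
      filter_upwards [hf.coeFn_toLp] with x hx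
      simp [hx, φ]
    exact ⟨i, h3, by rwa [eLpNorm_sub_comm]⟩
  obtain ⟨i, hi1, hi2⟩ := hclose f hf
  obtain ⟨j, hj1, hj2⟩ := hclose g hg
  have hφ : ∀ i, AEStronglyMeasurable (φ i) volume := fun i => Lp.aestronglyMeasurable _
  -- The replacement errors do not depend on `γ`, since both marginals are uniform.
  have tri : ∀ (γ : K) (f f' g g' : I → E), AEStronglyMeasurable f volume →
      AEStronglyMeasurable f' volume → AEStronglyMeasurable g volume →
      AEStronglyMeasurable g' volume → eLpNorm (fun z => f z.1 - g z.2) 2 γ.1 ≤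
      eLpNorm (f - f') 2 volume + eLpNorm (fun z => f' z.1 - g' z.2) 2 γ.1 +
        eLpNorm (g' - g) 2 volume := fun γ f f' g g' hf hf' hg hg' => by
    rw [← hnf γ _ (hf.sub hf'), ← hns γ _ (hg'.sub hg)]
    have e : (fun z : I × I => f z.1 - g z.2) = ((fun z : I × I => (f - f') z.1) +
        fun z => f' z.1 - g' z.2) + fun z => (g' - g) z.2 := by
      ext z; simp
    rw [e]
    refine (eLpNorm_add_le ((hmf γ _ (hf.sub hf')).add ((hmf γ _ hf').sub (hms γ _ hg')))
      (hms γ _ (hg'.sub hg)) (by norm_num)).trans ?_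
    gcongr
    exact eLpNorm_add_le (hmf γ _ (hf.sub hf')) ((hmf γ _ hf').sub (hms γ _ hg')) (by norm_num)
  let γ₀ : K := ⟨γ', h1, h2⟩
  -- Finiteness makes the inequality strict at `γ₀`, so the open set below is nonempty.
  have hfin : Ψ γ₀ (i, j) ≠ ∞ := by
    have : Ψ γ₀ (i, j) ≤ eLpNorm (fun z : I × I => φ i z.1) 2 γ' +
        eLpNorm (fun z : I × I => φ j z.2) 2 γ' :=
      eLpNorm_sub_le (hmf γ₀ _ (hφ i)) (hms γ₀ _ (hφ j)) (by norm_num)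
    rw [hnf γ₀ _ (hφ i), hns γ₀ _ (hφ j)] at this
    exact ne_top_of_le_ne_top (ENNReal.add_ne_top.2
      ⟨(Lp.memLp (φ i)).eLpNorm_ne_top, (Lp.memLp (φ j)).eLpNorm_ne_top⟩) this
  obtain ⟨_, hγ, n, rfl⟩ := (TopologicalSpace.denseRange_denseSeq K).inter_open_nonempty
    {γ | Ψ γ (i, j) < Ψ γ₀ (i, j) + ε / 5}
    (isOpen_lt ((continuous_apply (i, j)).comp hΨ.continuous) continuous_const)
    ⟨γ₀, ENNReal.lt_add_right hfin (ENNReal.div_pos hε.ne' (by norm_num)).ne'⟩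
  refine ⟨n, ?_⟩
  have t1 := tri (TopologicalSpace.denseSeq K n) f (φ i) g (φ j) hf.1 (hφ i) hg.1 (hφ j)
  have t2 := tri γ₀ (φ i) f (φ j) g (hφ i) hf.1 (hφ j) hg.1
  have hγ' : eLpNorm (fun z => φ i z.1 - φ j z.2) 2 (TopologicalSpace.denseSeq K n).1 ≤
    eLpNorm (fun z => φ i z.1 - φ j z.2) 2 γ' + ε / 5 := le_of_lt hγ
  calc _ ≤ _ := t1
    _ ≤ ε / 5 + ((ε / 5 + eLpNorm (fun z => f z.1 - g z.2) 2 γ' + ε / 5) + ε / 5) + ε / 5 := by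
      gcongr
      refine hγ'.trans ?_
      gcongr
      refine t2.trans ?_
      gcongr
    _ = eLpNorm (fun z => f z.1 - g z.2) 2 γ' + 5 * (ε / 5) := by ring
    _ = _ := by rw [ENNReal.mul_div_cancel (by norm_num) (by norm_num)]

/-! ### Couplings and `W2` as an infimum of `L²` norms -/

/-- A probability measure with the right marginals is a coupling: the moment condition is
automatic. -/
theorem mem_couplings_iff {X : Type*} [MeasurableSpace X] [EDist X]
    (hX : ∀ x₀ : X, Measurable fun x => edist x x₀) {μ ν : P2 X}
    {π : ProbabilityMeasure (X × X)} :
    π ∈ couplings μ ν ↔ (π : Measure (X × X)).map Prod.fst = μ.toPM ∧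
      (π : Measure (X × X)).map Prod.snd = ν.toPM := by
  constructor
  · rintro ⟨-, h1, h2⟩
    exact ⟨congrArg Subtype.val h1, congrArg Subtype.val h2⟩
  · rintro ⟨h1, h2⟩
    obtain ⟨x₀, hx₀⟩ := μ.finite_moment
    obtain ⟨y₀, hy₀⟩ := ν.finite_moment
    refine ⟨⟨x₀, y₀, ?_⟩, Subtype.ext h1, Subtype.ext h2⟩
    rw [lintegral_add_left (f := fun z : X × X => edist z.1 x₀ ^ 2)
      (((hX x₀).comp measurable_fst).pow_const 2), ENNReal.add_lt_top]
    rw [← h1, lintegral_map ((hX x₀).pow_const 2) measurable_fst] at hx₀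
    rw [← h2, lintegral_map ((hX y₀).pow_const 2) measurable_snd] at hy₀
    exact ⟨hx₀, hy₀⟩

/-- The law of `(f U, g V)`, where `(U, V)` has law `γ`, is a coupling of the laws of `f U` and
`g V`. -/
theorem map_mem_couplings {Ω E : Type*} [MeasurableSpace Ω] [NormedAddCommGroup E]
    [MeasurableSpace E] [BorelSpace E] {μ ν : P2 E} {m : Measure Ω}
    [IsProbabilityMeasure m] {F : Ω → E × E} (hF : Measurable F)
    (h1 : m.map (fun z => (F z).1) = μ.toPM) (h2 : m.map (fun z => (F z).2) = ν.toPM) :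
    (⟨m.map F, Measure.isProbabilityMeasure_map hF.aemeasurable⟩ : ProbabilityMeasure (E × E)) ∈
      couplings μ ν := by
  refine (mem_couplings_iff fun x₀ => by fun_prop).2 ⟨?_, ?_⟩
  · exact (Measure.map_map measurable_fst hF).trans h1
  · exact (Measure.map_map measurable_snd hF).trans h2

section

variable {E : Type*} [NormedAddCommGroup E] [MeasurableSpace E] [BorelSpace E]
  [SecondCountableTopology E]

theorem eLpNorm_two_sq {α F : Type*} [MeasurableSpace α] [NormedAddCommGroup F] (f : α → F)
    (m : Measure α) : eLpNorm f 2 m ^ 2 = ∫⁻ x, ‖f x‖ₑ ^ 2 ∂m := by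
  have := eLpNorm_nnreal_pow_eq_lintegral (f := f) (μ := m) (p := 2) (by norm_num)
  simpa using this

theorem measurable_lintegral_enorm_sub :
    Measurable fun π : ProbabilityMeasure (E × E) =>
      ∫⁻ z, ‖z.1 - z.2‖ₑ ^ 2 ∂(π : Measure (E × E)) :=
  (Measure.measurable_lintegral (by fun_prop)).comp measurable_subtype_coe

theorem measurable_eLpNorm_sub :
    Measurable fun π : ProbabilityMeasure (E × E) =>
      eLpNorm (fun z : E × E => z.1 - z.2) 2 (π : Measure (E × E)) := by
  have h : (fun π : ProbabilityMeasure (E × E) =>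
      eLpNorm (fun z : E × E => z.1 - z.2) 2 (π : Measure (E × E))) =
      fun π : ProbabilityMeasure (E × E) =>
        (∫⁻ z, ‖z.1 - z.2‖ₑ ^ 2 ∂(π : Measure (E × E))) ^ (1 / 2 : ℝ) := by
    ext1 π
    rw [← eLpNorm_two_sq, ← ENNReal.rpow_natCast, ← ENNReal.rpow_mul]
    norm_num
  rw [h]
  exact measurable_lintegral_enorm_sub.pow_const _

/-- `W₂` on a normed space as an infimum of `L²` norms. -/
theorem W2_eq_iInf_eLpNorm {E : Type*} [NormedAddCommGroup E] [MeasurableSpace E] (μ ν : P2 E) :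
    W2 μ ν = ⨅ π ∈ couplings μ ν, eLpNorm (fun z : E × E => z.1 - z.2) 2 (π : Measure (E × E)) := by
  -- The square root is an order isomorphism of `ℝ≥0∞`, so it commutes with the infimum.
  have h : ∀ x : ℝ≥0∞, x ^ (1 / 2 : ℝ) = ENNReal.orderIsoRpow (1 / 2) (by norm_num) x :=
    fun x => rfl
  rw [W2, h, OrderIso.map_iInf₂]
  refine iInf_congr fun π => iInf_congr fun _ => ?_
  rw [← h]
  simp_rw [edist_eq_enorm_sub]
  rw [← eLpNorm_two_sq, ← ENNReal.rpow_natCast, ← ENNReal.rpow_mul]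
  norm_num

theorem W2_le_eLpNorm {E : Type*} [NormedAddCommGroup E] [MeasurableSpace E] {μ ν : P2 E} {π : ProbabilityMeasure (E × E)} (hπ : π ∈ couplings μ ν) :
    W2 μ ν ≤ eLpNorm (fun z : E × E => z.1 - z.2) 2 (π : Measure (E × E)) := by
  rw [W2_eq_iInf_eLpNorm]
  exact iInf₂_le _ hπ

/-- Constants are square integrable for a probability measure, so the base point of the moment
condition is immaterial. -/
theorem P2.memLp_id (μ : P2 E) : MemLp id 2 (μ.toPM : Measure E) := by
  obtain ⟨x₀, hx₀⟩ := μ.finite_moment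
  have h : MemLp (fun x => x - x₀) 2 (μ.toPM : Measure E) := by
    refine ⟨by fun_prop, ?_⟩
    refine (ENNReal.pow_lt_top_iff.1 (?_ : _ ^ 2 < ∞)).resolve_right two_ne_zero
    rw [eLpNorm_two_sq]
    simpa only [edist_eq_enorm_sub] using hx₀
  have := h.add (memLp_const x₀)
  convert this using 1
  ext x
  simp

theorem W2_comm (μ ν : P2 E) : W2 μ ν = W2 ν μ := by
  suffices h : ∀ μ ν : P2 E, W2 μ ν ≤ W2 ν μ from le_antisymm (h _ _) (h _ _)
  intro μ ν
  rw [W2_eq_iInf_eLpNorm ν μ]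
  refine le_iInf₂ fun π hπ => ?_
  obtain ⟨h1, h2⟩ := (mem_couplings_iff fun x₀ => by fun_prop).1 hπ
  refine (W2_le_eLpNorm (map_mem_couplings (m := (π : Measure (E × E))) measurable_swap h2 h1)).trans
    (le_of_eq ?_)
  change eLpNorm _ 2 ((π : Measure (E × E)).map Prod.swap) = _
  rw [eLpNorm_map_measure (by fun_prop) (by fun_prop), ← eLpNorm_neg]
  congr 1
  ext z
  simp

variable [CompleteSpace E]

/-! ### Measurable families of couplings -/

/-- Countably many measurable ways of coupling two probability measures suffice to compute the
Wasserstein distance. -/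
theorem exists_seq_measurable_couplings (E : Type*) [NormedAddCommGroup E] [MeasurableSpace E]
    [BorelSpace E] [SecondCountableTopology E] [CompleteSpace E] :
    ∃ M : ℕ → ProbabilityMeasure E × ProbabilityMeasure E → ProbabilityMeasure (E × E),
      (∀ n, Measurable (M n)) ∧
      (∀ n, ∀ μ ν : P2 E, M n (μ.toPM, ν.toPM) ∈ couplings μ ν) ∧
      ∀ μ ν : P2 E, W2 μ ν = ⨅ n, eLpNorm (fun z : E × E => z.1 - z.2) 2
        (M n (μ.toPM, ν.toPM) : Measure (E × E)) := by
  -- The tautological kernel, sending a measure to itself; its representation by uniform noise is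
  -- jointly measurable in the measure and the noise.
  let κ : Kernel (ProbabilityMeasure E) E := ⟨Subtype.val, measurable_subtype_coe⟩
  have : IsMarkovKernel κ := ⟨fun μ => μ.2⟩
  obtain ⟨f, hf, hfκ⟩ := κ.exists_measurable_map_eq_unitInterval
  have hfm : ∀ m, Measurable (f m) := fun m => hf.of_uncurry_left
  have hfL : ∀ μ : P2 E, MemLp (f μ.toPM) 2 volume := fun μ => by
    have := μ.memLp_id
    rw [show (μ.toPM : Measure E) = volume.map (f μ.toPM) from (hfκ μ.toPM).symm] at this
    exact this.comp_of_map (hfm _).aemeasurable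
  obtain ⟨γ, hγ, hγd⟩ := exists_seq_uniform_couplings E
  have hγp : ∀ n, IsProbabilityMeasure (γ n) := fun n => by
    have : IsProbabilityMeasure ((γ n).map Prod.fst) := by rw [(hγ n).1]; infer_instance
    exact Measure.isProbabilityMeasure_of_map Prod.fst
  have hF : ∀ p : ProbabilityMeasure E × ProbabilityMeasure E,
      Measurable fun z : I × I => (f p.1 z.1, f p.2 z.2) := fun p =>
    ((hfm p.1).comp measurable_fst).prodMk ((hfm p.2).comp measurable_snd)
  have hM : ∀ n, ∀ μ ν : P2 E,
      (⟨(γ n).map fun z : I × I => (f μ.toPM z.1, f ν.toPM z.2),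
        Measure.isProbabilityMeasure_map (hF (μ.toPM, ν.toPM)).aemeasurable⟩ :
          ProbabilityMeasure (E × E)) ∈ couplings μ ν := fun n μ ν => by
    refine map_mem_couplings (hF (μ.toPM, ν.toPM)) ?_ ?_
    · change (γ n).map (f μ.toPM ∘ Prod.fst) = _
      rw [← Measure.map_map (hfm _) measurable_fst, (hγ n).1]
      exact hfκ _
    · change (γ n).map (f ν.toPM ∘ Prod.snd) = _
      rw [← Measure.map_map (hfm _) measurable_snd, (hγ n).2]
      exact hfκ _
  refine ⟨fun n p => ⟨(γ n).map fun z : I × I => (f p.1 z.1, f p.2 z.2),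
    Measure.isProbabilityMeasure_map (hF p).aemeasurable⟩, fun n => ?_, hM, fun μ ν => ?_⟩
  · refine Measurable.subtype_mk (Measure.measurable_of_measurable_coe _ fun s hs => ?_)
    simp_rw [Measure.map_apply (hF _) hs]
    have h2 : Measurable fun q : (ProbabilityMeasure E × ProbabilityMeasure E) × I × I =>
        (f q.1.1 q.2.1, f q.1.2 q.2.2) :=
      (hf.comp ((measurable_fst.comp measurable_fst).prodMk
        (measurable_fst.comp measurable_snd))).prodMk
      (hf.comp ((measurable_snd.comp measurable_fst).prodMk
        (measurable_snd.comp measurable_snd)))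
    exact measurable_measure_prodMk_left (h2 hs)
  · refine le_antisymm (le_iInf fun n => W2_le_eLpNorm (hM n μ ν)) ?_
    rw [W2_eq_iInf_eLpNorm]
    refine le_iInf₂ fun π hπ => ?_
    obtain ⟨h1, h2⟩ := (mem_couplings_iff fun x₀ => by fun_prop).1 hπ
    obtain ⟨γ', hγ1, hγ2, hγ'⟩ := exists_uniform_coupling_map_eq (hfm μ.toPM) (hfm ν.toPM)
      (π : Measure (E × E)) (h1.trans (hfκ _).symm) (h2.trans (hfκ _).symm)
    have hmeas : ∀ m : Measure (E × E), AEStronglyMeasurable (fun z : E × E => z.1 - z.2) m :=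
      fun m => by fun_prop
    refine ENNReal.le_of_forall_pos_le_add fun ε hε _ => ?_
    obtain ⟨n, hn⟩ := hγd γ' hγ1 hγ2 _ _ (hfL μ) (hfL ν) ε (by simpa using hε)
    refine (iInf_le _ n).trans ?_
    rw [← hγ', eLpNorm_map_measure (hmeas _) ((hfm _).prodMap (hfm _)).aemeasurable]
    change eLpNorm _ 2 ((γ n).map _) ≤ _
    rw [eLpNorm_map_measure (hmeas _) (hF (μ.toPM, ν.toPM)).aemeasurable]
    exact hn

/-! ### Topology and Borel structure of `𝒫₂(E)` -/

theorem W2_triangle (μ ν ρ : P2 E) : W2 μ ρ ≤ W2 μ ν + W2 ν ρ := by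
  rw [W2_eq_iInf_eLpNorm μ ν, W2_eq_iInf_eLpNorm ν ρ]
  simp only [ENNReal.iInf_add]
  refine le_iInf₂ fun π hπ => ?_
  simp only [ENNReal.add_iInf]
  refine le_iInf₂ fun θ hθ => ?_
  obtain ⟨h1, h2⟩ := (mem_couplings_iff fun x₀ => by fun_prop).1 hπ
  obtain ⟨h3, h4⟩ := (mem_couplings_iff fun x₀ => by fun_prop).1 hθ
  obtain ⟨τ, _, h5, h6⟩ := exists_gluing (π : Measure (E × E)) (θ : Measure (E × E))
    (h2.trans h3.symm)
  have hF : Measurable fun z : E × E × E => (z.1, z.2.2) := by fun_prop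
  refine (W2_le_eLpNorm (map_mem_couplings (m := τ) hF ?_ ?_)).trans ?_
  · rw [← h1, ← h5, Measure.map_map (by fun_prop) (by fun_prop)]; rfl
  · rw [← h4, ← h6, Measure.map_map (by fun_prop) (by fun_prop)]; rfl
  change eLpNorm _ 2 (τ.map _) ≤ _
  rw [← h5, ← h6, eLpNorm_map_measure (by fun_prop) (by fun_prop),
    eLpNorm_map_measure (by fun_prop) (by fun_prop),
    eLpNorm_map_measure (by fun_prop) (by fun_prop)]
  refine le_trans (le_of_eq ?_) (eLpNorm_add_le (by fun_prop) (by fun_prop) (by norm_num))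
  congr 1
  ext z
  simp

/-- Laws of a dense sequence of `L²(I; E)` suffice: if `μ` is the law of `f`, then `(f, φ n)` is a
coupling whose cost is the `L²` distance. -/
theorem exists_countable_dense_P2 (E : Type*) [NormedAddCommGroup E] [MeasurableSpace E]
    [BorelSpace E] [SecondCountableTopology E] [CompleteSpace E] :
    ∃ S : ℕ → P2 E, ∀ μ : P2 E, ∀ ε : ℝ≥0∞, 0 < ε → ∃ n, W2 μ (S n) < ε := by
  have : Fact ((1 : ℝ≥0∞) ≤ 2) := ⟨by norm_num⟩
  have : Fact ((2 : ℝ≥0∞) ≠ ∞) := ⟨by norm_num⟩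
  let φ : ℕ → Lp E 2 (volume : Measure I) := TopologicalSpace.denseSeq _
  have hφ : ∀ n, Measurable (φ n) := fun n => (Lp.stronglyMeasurable _).measurable
  refine ⟨fun n => ⟨⟨(volume : Measure I).map (φ n),
    Measure.isProbabilityMeasure_map (hφ n).aemeasurable⟩, 0, ?_⟩, fun μ ε hε => ?_⟩
  · change ∫⁻ x, edist x 0 ^ 2 ∂((volume : Measure I).map (φ n)) < ∞
    rw [lintegral_map (by fun_prop) (hφ n)]
    simp_rw [edist_zero_right]
    rw [← eLpNorm_two_sq]
    exact ENNReal.pow_lt_top (Lp.memLp (φ n)).eLpNorm_lt_top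
  · obtain ⟨f, hf, hfμ⟩ := (μ.toPM : Measure E).exists_measurable_map_eq
    have hfL : MemLp f 2 volume := by
      have := μ.memLp_id
      rw [← hfμ] at this
      exact this.comp_of_map hf.aemeasurable
    obtain ⟨_, ⟨n, rfl⟩, hn⟩ := EMetric.mem_closure_iff.1
      ((TopologicalSpace.denseRange_denseSeq (Lp E 2 (volume : Measure I))).closure_eq ▸
        Set.mem_univ (hfL.toLp f)) ε hε
    refine ⟨n, lt_of_le_of_lt (W2_le_eLpNorm (map_mem_couplings (m := (volume : Measure I))
      (hf.prodMk (hφ n)) hfμ rfl)) ?_⟩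
    change eLpNorm _ 2 ((volume : Measure I).map _) < ε
    rw [eLpNorm_map_measure (by fun_prop) (hf.prodMk (hφ n)).aemeasurable]
    rw [Lp.edist_def] at hn
    refine lt_of_eq_of_lt (eLpNorm_congr_ae ?_) hn
    filter_upwards [hfL.coeFn_toLp] with x hx
    simp [hx, φ]

/-- By symmetry and the triangle inequality, every ball is a union of balls with centre in the dense
sequence and radius `1 / q`. The index `q = 0` gives radius `∞`, still a legitimate ball. -/
instance P2.instSecondCountableTopology : SecondCountableTopology (P2 E) := by
  obtain ⟨S, hS⟩ := exists_countable_dense_P2 E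
  let C : Set (Set (P2 E)) := Set.range fun a : ℕ × ℕ => {ν | W2 (S a.1) ν < (a.2 : ℝ≥0∞)⁻¹}
  refine ⟨C, Set.countable_range _, le_antisymm ?_ ?_⟩
  · refine TopologicalSpace.generateFrom_anti ?_
    rintro _ ⟨a, rfl⟩
    exact ⟨_, _, rfl⟩
  · refine le_generateFrom ?_
    rintro _ ⟨μ, r, rfl⟩
    have : {ν | W2 μ ν < r} = ⋃₀ {c | c ∈ C ∧ c ⊆ {ν | W2 μ ν < r}} := by
      refine Set.Subset.antisymm (fun ν hν => ?_) (Set.sUnion_subset fun c hc => hc.2)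
      have hν : W2 μ ν < r := hν
      obtain ⟨q, hq⟩ := ENNReal.exists_inv_nat_lt
        (ENNReal.div_pos (tsub_pos_of_lt hν).ne' ENNReal.ofNat_ne_top : 0 < (r - W2 μ ν) / 2).ne'
      have hq' : W2 μ ν + ((q : ℝ≥0∞)⁻¹ + (q : ℝ≥0∞)⁻¹) < r := by
        refine lt_tsub_iff_left.1 ?_
        calc _ < (r - W2 μ ν) / 2 + (r - W2 μ ν) / 2 := ENNReal.add_lt_add hq hq
          _ = _ := ENNReal.add_halves _
      have hq0' : (0 : ℝ≥0∞) < (q : ℝ≥0∞)⁻¹ := by simp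
      obtain ⟨n, hn⟩ := hS ν _ hq0'
      refine ⟨_, ⟨⟨(n, q), rfl⟩, fun ρ hρ => ?_⟩, by rwa [W2_comm] at hn⟩
      have hρ : W2 (S n) ρ < (q : ℝ≥0∞)⁻¹ := hρ
      refine lt_of_le_of_lt ?_ hq'
      refine (W2_triangle μ ν ρ).trans (add_le_add le_rfl ?_)
      exact (W2_triangle ν (S n) ρ).trans (add_le_add hn.le hρ.le)
    rw [this]
    exact TopologicalSpace.GenerateOpen.sUnion _ fun c hc => .basic c hc.1

/-- A map into `𝒫₂(E)` is measurable as soon as it is measurable as a map into `𝒫(E)`. -/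
theorem measurable_P2_of_toPM {α : Type*} [MeasurableSpace α] {g : α → P2 E}
    (hg : Measurable fun a => (g a).toPM) : Measurable g := by
  obtain ⟨M, hM, -, hW⟩ := exists_seq_measurable_couplings E
  -- Second countability lets the balls, a mere subbasis, generate the Borel σ-algebra; a ball is
  -- then tested through `W2 μ`, which depends measurably on the underlying measure alone.
  rw [show P2.instMeasurableSpace (X := E) = _ from
    borel_eq_generateFrom_of_subbasis (α := P2 E) rfl]
  refine measurable_generateFrom ?_
  rintro _ ⟨μ, r, rfl⟩
  suffices h : Measurable fun a => W2 μ (g a) from measurableSet_lt h measurable_const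
  simp_rw [hW]
  refine Measurable.iInf fun n => ?_
  exact measurable_eLpNorm_sub.comp ((hM n).comp (measurable_const.prodMk hg))

/-- The Wasserstein distance is a measurable function of both arguments. -/
theorem measurable_W2 : Measurable fun p : P2 E × P2 E => W2 p.1 p.2 := by
  obtain ⟨M, hM, -, hW⟩ := exists_seq_measurable_couplings E
  simp_rw [hW]
  exact Measurable.iInf fun n => measurable_eLpNorm_sub.comp ((hM n).comp
    ((P2.measurable_toPM.comp measurable_fst).prodMk (P2.measurable_toPM.comp measurable_snd)))

/-- This makes `mem_couplings_iff` available for outer plans, where `X = 𝒫₂(E)`. -/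
theorem measurable_edist_P2 (x₀ : P2 E) : Measurable fun x : P2 E => edist x x₀ := by
  have hx : Measurable fun x : P2 E => (x, x₀) := measurable_prodMk_right
  have h := measurable_W2.comp hx
  exact h

/-- The inclusion `𝒫₂(E) → 𝒫(E)` has a measurable left inverse and a measurable range. -/
theorem exists_measurable_leftInverse_toPM (E : Type*) [NormedAddCommGroup E] [MeasurableSpace E]
    [BorelSpace E] [SecondCountableTopology E] [CompleteSpace E] :
    ∃ r : ProbabilityMeasure E → P2 E, Measurable r ∧ (∀ μ : P2 E, r μ.toPM = μ) ∧
      MeasurableSet (Set.range (P2.toPM : P2 E → ProbabilityMeasure E)) := by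
  classical
  have h0 : ∫⁻ x : E, edist x 0 ^ 2 ∂(Measure.dirac 0) < ∞ := by
    rw [lintegral_dirac' _ (by fun_prop)]; simp
  -- Measures of infinite second moment go to the Dirac mass at `0`, an arbitrary default.
  let r : ProbabilityMeasure E → P2 E := fun m =>
    if h : ∫⁻ x, edist x 0 ^ 2 ∂(m : Measure E) < ∞ then ⟨m, 0, h⟩
    else ⟨⟨Measure.dirac 0, inferInstance⟩, 0, h0⟩
  have hfin : ∀ μ : P2 E, ∫⁻ x, edist x 0 ^ 2 ∂(μ.toPM : Measure E) < ∞ := fun μ => by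
    simp_rw [edist_zero_right]
    rw [← eLpNorm_two_sq]
    exact ENNReal.pow_lt_top μ.memLp_id.eLpNorm_lt_top
  have hset : MeasurableSet {m : ProbabilityMeasure E |
      ∫⁻ x, edist x 0 ^ 2 ∂(m : Measure E) < ∞} :=
    measurableSet_lt ((Measure.measurable_lintegral (by fun_prop)).comp
      measurable_subtype_coe) measurable_const
  refine ⟨r, measurable_P2_of_toPM ?_, fun μ => ?_, ?_⟩
  · have hr : (fun m => (r m).toPM) = fun m : ProbabilityMeasure E =>
        if ∫⁻ x, edist x 0 ^ 2 ∂(m : Measure E) < ∞ then m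
        else ⟨Measure.dirac 0, inferInstance⟩ := by
      ext1 m
      by_cases h : ∫⁻ x, edist x 0 ^ 2 ∂(m : Measure E) < ∞
      · simp only [r, dif_pos h]
        exact (if_pos h).symm
      · simp only [r, dif_neg h]
        exact (if_neg h).symm
    rw [hr]
    exact Measurable.ite hset measurable_id measurable_const
  · simp only [r, dif_pos (hfin μ)]
  · convert hset using 1
    ext m
    exact ⟨fun ⟨μ, hμ⟩ => hμ ▸ hfin μ, fun h => ⟨⟨m, 0, h⟩, rfl⟩⟩

end

/-! ### Random couplings against outer plans -/

/-- The push-forward of an outer plan by a family of couplings is a random coupling. -/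
theorem map_mem_randomCouplings {d : ℕ} {μ ν : P2 (P2 (Euc d))}
    {OP : ProbabilityMeasure (P2 (Euc d) × P2 (Euc d))} (hOP : OP ∈ couplings μ ν)
    {IP : P2 (Euc d) × P2 (Euc d) → ProbabilityMeasure (Euc d × Euc d)}
    (hc : ∀ p, IP p ∈ couplings p.1 p.2)
    (hIP : AEMeasurable IP (OP : Measure (P2 (Euc d) × P2 (Euc d)))) :
    OP.map hIP ∈ randomCouplings μ ν := by
  have h1 : (OP : Measure (P2 (Euc d) × P2 (Euc d))).map Prod.fst = μ.toPM :=
    congrArg Subtype.val hOP.2.1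
  have h2 : (OP : Measure (P2 (Euc d) × P2 (Euc d))).map Prod.snd = ν.toPM :=
    congrArg Subtype.val hOP.2.2
  constructor
  · refine Subtype.ext ?_
    simp only [ProbabilityMeasure.val_eq_to_measure, ProbabilityMeasure.toMeasure_map]
    rw [← h1, AEMeasurable.map_map_of_aemeasurable (measurable_probabilityMeasure_map
      measurable_fst).aemeasurable hIP, Measure.map_map P2.measurable_toPM measurable_fst]
    congr 1
    ext1 p
    exact (hc p).2.1
  · refine Subtype.ext ?_
    simp only [ProbabilityMeasure.val_eq_to_measure, ProbabilityMeasure.toMeasure_map]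
    rw [← h2, AEMeasurable.map_map_of_aemeasurable (measurable_probabilityMeasure_map
      measurable_snd).aemeasurable hIP, Measure.map_map P2.measurable_toPM measurable_snd]
    congr 1
    ext1 p
    exact (hc p).2.2

/-- Measurable selection of almost optimal couplings. -/
theorem exists_measurable_almost_optimal (E : Type*) [NormedAddCommGroup E] [MeasurableSpace E]
    [BorelSpace E] [SecondCountableTopology E] [CompleteSpace E] {ε : ℝ≥0∞} (hε : 0 < ε) :
    ∃ IP : P2 E × P2 E → ProbabilityMeasure (E × E), Measurable IP ∧
      (∀ p, IP p ∈ couplings p.1 p.2) ∧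
      ∀ p, ∫⁻ z, ‖z.1 - z.2‖ₑ ^ 2 ∂(IP p : Measure (E × E)) ≤ W2 p.1 p.2 ^ 2 + ε := by
  classical
  obtain ⟨M, hM, hMc, hW⟩ := exists_seq_measurable_couplings E
  let c : ℕ → P2 E × P2 E → ℝ≥0∞ := fun n p =>
    ∫⁻ z, ‖z.1 - z.2‖ₑ ^ 2 ∂(M n (p.1.toPM, p.2.toPM) : Measure (E × E))
  have hpair : Measurable fun p : P2 E × P2 E => (p.1.toPM, p.2.toPM) :=
    (P2.measurable_toPM.comp measurable_fst).prodMk (P2.measurable_toPM.comp measurable_snd)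
  have hcm : ∀ n, Measurable (c n) := fun n =>
    measurable_lintegral_enorm_sub.comp ((hM n).comp hpair)
  have hWc : ∀ p : P2 E × P2 E, W2 p.1 p.2 ^ 2 = ⨅ n, c n p := fun p => by
    have h2 : ∀ x : ℝ≥0∞, x ^ 2 = ENNReal.orderIsoRpow 2 (by norm_num) x := fun x =>
      (ENNReal.rpow_two x).symm
    rw [hW, h2, OrderIso.map_iInf]
    exact iInf_congr fun n => by rw [← h2, eLpNorm_two_sq]
  have hex : ∀ p, ∃ n, c n p ≤ W2 p.1 p.2 ^ 2 + ε := fun p => by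
    -- Splitting here avoids proving that `W2` is finite.
    by_cases htop : W2 p.1 p.2 ^ 2 = ∞
    · exact ⟨0, by simp [htop]⟩
    · have := ENNReal.lt_add_right htop hε.ne'
      nth_rewrite 1 [hWc] at this
      obtain ⟨n, hn⟩ := iInf_lt_iff.1 this
      exact ⟨n, hn.le⟩
  refine ⟨fun p => M (Nat.find (hex p)) (p.1.toPM, p.2.toPM), ?_, fun p => hMc _ _ _,
    fun p => Nat.find_spec (hex p)⟩
  -- Taking the first index within tolerance keeps the selection measurable.
  have hN : Measurable fun p => Nat.find (hex p) := measurable_find hex fun n =>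
    measurableSet_le (hcm n) ((measurable_W2.pow_const 2).add_const ε)
  have hMu : Measurable fun q : ℕ × (ProbabilityMeasure E × ProbabilityMeasure E) => M q.1 q.2 :=
    measurable_from_prod_countable_right hM
  exact hMu.comp (hN.prodMk hpair)

theorem W2_sq_eq_iInf {X : Type*} [MeasurableSpace X] [EDist X] (μ ν : P2 X) :
    W2 μ ν ^ 2 = ⨅ π ∈ couplings μ ν, ∫⁻ z, edist z.1 z.2 ^ 2 ∂(π : Measure (X × X)) := by
  rw [W2, ← ENNReal.rpow_natCast, ← ENNReal.rpow_mul]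
  norm_num

/-- Every random coupling induces an outer plan of at most the same cost. -/
theorem W2_sq_le_of_mem_randomCouplings {d : ℕ} {μ ν : P2 (P2 (Euc d))}
    {Γ : ProbabilityMeasure (ProbabilityMeasure (Euc d × Euc d))}
    (hΓ : Γ ∈ randomCouplings μ ν) :
    W2 μ ν ^ 2 ≤ ∫⁻ π : ProbabilityMeasure (Euc d × Euc d),
      ∫⁻ z : Euc d × Euc d, ‖z.1 - z.2‖ₑ ^ 2 ∂(π : Measure (Euc d × Euc d))
        ∂(Γ : Measure (ProbabilityMeasure (Euc d × Euc d))) := by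
  obtain ⟨r, hr, hrl, hrange⟩ := exists_measurable_leftInverse_toPM (Euc d)
  obtain ⟨p1, hp1, h1, hp1c⟩ : ∃ p1 : ProbabilityMeasure (Euc d × Euc d) →
      ProbabilityMeasure (Euc d), Measurable p1 ∧ (Γ : Measure _).map p1 =
        (μ.toPM : Measure (P2 (Euc d))).map P2.toPM ∧
      ∀ π, (p1 π : Measure (Euc d)) = (π : Measure (Euc d × Euc d)).map Prod.fst :=
    ⟨_, measurable_probabilityMeasure_map measurable_fst, congrArg Subtype.val hΓ.1, fun _ => rfl⟩
  obtain ⟨p2, hp2, h2, hp2c⟩ : ∃ p2 : ProbabilityMeasure (Euc d × Euc d) →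
      ProbabilityMeasure (Euc d), Measurable p2 ∧ (Γ : Measure _).map p2 =
        (ν.toPM : Measure (P2 (Euc d))).map P2.toPM ∧
      ∀ π, (p2 π : Measure (Euc d)) = (π : Measure (Euc d × Euc d)).map Prod.snd :=
    ⟨_, measurable_probabilityMeasure_map measurable_snd, congrArg Subtype.val hΓ.2, fun _ => rfl⟩
  have hΦ : Measurable fun π => (r (p1 π), r (p2 π)) := (hr.comp hp1).prodMk (hr.comp hp2)
  have hinv : ∀ m : Measure (P2 (Euc d)), (m.map P2.toPM).map r = m := fun m => by
    rw [Measure.map_map hr P2.measurable_toPM, show r ∘ P2.toPM = id from funext hrl,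
      Measure.map_id]
  have hOP : Γ.map hΦ.aemeasurable ∈ couplings μ ν := by
    refine (mem_couplings_iff measurable_edist_P2).2 ⟨?_, ?_⟩
    · rw [ProbabilityMeasure.toMeasure_map, Measure.map_map measurable_fst hΦ]
      change (Γ : Measure _).map (r ∘ p1) = _
      rw [← Measure.map_map hr hp1, h1, hinv]
    · rw [ProbabilityMeasure.toMeasure_map, Measure.map_map measurable_snd hΦ]
      change (Γ : Measure _).map (r ∘ p2) = _
      rw [← Measure.map_map hr hp2, h2, hinv]
  -- The marginals of `Γ`-almost every `π` lie in the range of `P2.toPM`, where `r` changes nothing;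
  -- such a `π` is therefore a coupling of their images under `r`.
  have hmem : ∀ m : Measure (P2 (Euc d)), ∀ᵐ x ∂(m.map P2.toPM), (r x).toPM = x := fun m => by
    have hr' : ∀ᵐ x ∂(m.map P2.toPM), x ∈ Set.range (P2.toPM : P2 (Euc d) → _) :=
      (ae_map_iff P2.measurable_toPM.aemeasurable hrange).2 (by simp)
    filter_upwards [hr'] with x hx
    obtain ⟨y, rfl⟩ := hx
    rw [hrl]
  have ha1 : ∀ᵐ π ∂(Γ : Measure (ProbabilityMeasure (Euc d × Euc d))), (r (p1 π)).toPM = p1 π :=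
    ae_of_ae_map hp1.aemeasurable (h1 ▸ hmem _)
  have ha2 : ∀ᵐ π ∂(Γ : Measure (ProbabilityMeasure (Euc d × Euc d))), (r (p2 π)).toPM = p2 π :=
    ae_of_ae_map hp2.aemeasurable (h2 ▸ hmem _)
  rw [W2_sq_eq_iInf]
  refine (iInf₂_le _ hOP).trans ?_
  have hcost : Measurable fun z : P2 (Euc d) × P2 (Euc d) => edist z.1 z.2 ^ 2 :=
    measurable_W2.pow_const 2
  rw [ProbabilityMeasure.toMeasure_map, lintegral_map hcost hΦ]
  refine lintegral_mono_ae ?_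
  filter_upwards [ha1, ha2] with π e1 e2
  change W2 (r (p1 π)) (r (p2 π)) ^ 2 ≤ _
  rw [← eLpNorm_two_sq]
  gcongr
  refine W2_le_eLpNorm ((mem_couplings_iff fun x₀ => by fun_prop).2 ⟨?_, ?_⟩)
  · rw [e1, hp1c]
  · rw [e2, hp2c]

theorem lemma2p3 (d : ℕ) (μ ν : P2 (P2 (Euc d))) :
    (∀ OP ∈ couplings μ ν,
      ∀ IP : P2 (Euc d) × P2 (Euc d) → ProbabilityMeasure (Euc d × Euc d),
        (∀ p, IP p ∈ couplings p.1 p.2) →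
        ∀ hIP : AEMeasurable IP (OP : Measure (P2 (Euc d) × P2 (Euc d))),
          OP.map hIP ∈ randomCouplings μ ν) ∧
    W2 μ ν ^ 2 =
      ⨅ Γ ∈ randomCouplings μ ν,
        ∫⁻ π : ProbabilityMeasure (Euc d × Euc d),
          ∫⁻ z : Euc d × Euc d, ‖z.1 - z.2‖ₑ ^ 2 ∂(π : Measure (Euc d × Euc d))
            ∂(Γ : Measure (ProbabilityMeasure (Euc d × Euc d))) := by
  refine ⟨fun OP hOP IP hc hIP => map_mem_randomCouplings hOP hc hIP,
    le_antisymm (le_iInf₂ fun Γ hΓ => W2_sq_le_of_mem_randomCouplings hΓ) ?_⟩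
  rw [W2_sq_eq_iInf]
  refine le_iInf₂ fun OP hOP => ENNReal.le_of_forall_pos_le_add fun ε hε _ => ?_
  obtain ⟨IP, hIP, hc, hcost⟩ := exists_measurable_almost_optimal (Euc d)
    (ENNReal.coe_pos.2 hε)
  refine (iInf₂_le _ (map_mem_randomCouplings hOP hc hIP.aemeasurable)).trans ?_
  rw [ProbabilityMeasure.toMeasure_map, lintegral_map measurable_lintegral_enorm_sub hIP]
  refine (lintegral_mono hcost).trans (le_of_eq ?_)
  -- `OP` has total mass one, so the constant `ε` integrates to `ε`.
  rw [lintegral_add_right _ measurable_const]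
  simp
  rfl
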